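/- Let $n\ge 2$, let $\{\nu^1,\dots,\nu^n\}$ be an orthonormal basis of $\mathbb R^n$, and let $\mathcal S^n$ be the real symmetric $n\times n$ matrices, where $X\le Y$ means that $Y-X$ is positive semidefinite. An (open) $1$-infinite cylinder with axis $\nu^i$ is a set $$C=\{x\in\mathbb R^n:\ a_h<x\cdot\nu^h<a_h+d_h\ \text{ for all } h\ne i\},\qquad a_h\in\mathbb R,\ d_h>0 .$$ Let $R=C_1\cup\dots\cup C_m$ be a lattice domain, i.e. a finite union of $1$-infinite cylinders $C_j$ with axes in $\{\nu^1,\dots,\nu^n\}$ such that two different cylinders of the family with the same axis direction are disjoint (cylinders with different axes may cross). Let $N$ be the set of points that belong to more than one of the cylinders. Let $F=F(x,s,p,X)$ be real-valued and satisfy, for each cylinder $C=C_j$, with axis $\nu^i$ and $U=(\nu^i)^\perp$, the structure condition $(SC)_{U,C}$: 1. $F$ is continuous on $C\times\mathbb R\times\mathbb R^n\times\mathcal S^n$; for $x\in C$: $F(x,s,p,X)\le F(x,s,p,Y)$ if $X\le Y$, $F(x,s,p,X)\le F(x,r,p,X)$ if $s>r$, and $F(x,0,0,O)=0$; 2. there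 are some $\nu\in\{\nu^h:h\ne i\}$ and a continuous $\lambda>0$ on $C$ with $\liminf_{x\to\infty,\,x\in C}\lambda(x)>0$ such that $F(x,0,p,X+t\,\nu\otimes\nu)-F(x,0,p,X)\ge\lambda(x)t$ for all $x\in C$, $p\in\mathbb R^n$, $X\in\mathcal S^n$, $t>0$; 3. there are $\Lambda_1>0$ and a continuous $\Lambda$ on $C$ with $0\le\Lambda(x)\le\Lambda_1|x|$ such that, for all $x\in C$ with $|x|$ large enough, all $X\in\mathcal S^n$ and all $t>0$, $F(x,0,0,X+tQ)-F(x,0,0,X)\le\Lambda(x)t$, where $Q=\nu^i\otimes\nu^i$ is the orthogonal projection onto $U^\perp$; 4. there is a continuous bounded $\gamma$ on $C$ with $\gamma/\lambda$ bounded above by a constant $\Gamma\ge0$ in $C$ and $|F(x,0,p,X)-F(x,0,q,X)|\le\gamma(x)|p-q|$ for all $x\in C$, $p,q\in\mathbb R^n$, $X\in\mathcal S^n$. Suppose in addition that $F$ is uniformly elliptic in $N$: there are constants $0<\lambda_0\le\Lambda_0$ with $$\lambda_0\operatorname{tr}Y\le F(x,s,p,X+Y)-F(x,s,p,X)\le\Lambda_0\operatorname{tr}Y$$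 for all $x\in N$, $s\in\mathbb R$, $p\in\mathbb R^n$, $X,Y\in\mathcal S^n$ with $Y\ge O$. Let $\Omega\subseteq R$ be open and connected, and let $u:\overline\Omega\to\mathbb R$ be upper semicontinuous, a viscosity subsolution of $F(x,u,Du,D^2u)\ge0$ in $\Omega$, with $u\le0$ on $\partial\Omega$ and $u_0^+(x)=o(|x|)$ as $|x|\to\infty$ in $\Omega$, where $u_0^+=\max(u,0)$ on $\overline\Omega$ and $u_0^+=0$ elsewhere. Then $u\le0$ in $\Omega$. -/

import Mathlib

open Set Filter Topology Asymptotics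

namespace LatticeMP

/-- Euclidean space `ℝⁿ`. -/
abbrev E (n : ℕ) : Type := EuclideanSpace ℝ (Fin n)

/-- Real `n × n` matrices; the operators below are only ever used at symmetric ones. -/
abbrev Mat (n : ℕ) : Type := Matrix (Fin n) (Fin n) ℝ

/-- A nonlinear second order operator `F(x, s, p, X)`; only its values for `x` in the region under
consideration and `X` symmetric matter. -/
abbrev Operator (n : ℕ) : Type := E n → ℝ → E n → Mat n → ℝ

/-- The matrix `v ⊗ v`. -/
def tensorSq {n : ℕ} (v : E n) : Mat n := Matrix.of fun i j => v i * v j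

/-- The Hessian matrix of `φ` at `x`. -/
noncomputable def hessian {n : ℕ} (φ : E n → ℝ) (x : E n) : Mat n :=
  Matrix.of fun i j =>
    fderiv ℝ (fderiv ℝ φ) x (EuclideanSpace.single i 1) (EuclideanSpace.single j 1)

/-- `u` is a viscosity subsolution in the open set `Ω`, that is `F(x, u, Du, D²u) ≥ 0` in `Ω`:
whenever `φ` is `C²` in `Ω` and `u - φ` has a local maximum at `x ∈ Ω`, the inequality holds at `x`
with the derivatives of `φ`. -/
def IsViscositySubsolution {n : ℕ} (F : Operator n) (Ω : Set (E n)) (u : E n → ℝ) : Prop :=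
  ∀ φ : E n → ℝ, ContDiffOn ℝ 2 φ Ω → ∀ x ∈ Ω,
    IsLocalMaxOn (fun y => u y - φ y) Ω x →
      0 ≤ F x (u x) (gradient φ x) (hessian φ x)

/-- The orthogonal projection matrix onto `U^⊥`, where `U` is spanned by the vectors `ν^h`, `h ∈ S`,
of the orthonormal basis `ν`. -/
noncomputable def projPerp {n : ℕ} (ν : OrthonormalBasis (Fin n) ℝ (E n)) (S : Finset (Fin n)) :
    Mat n :=
  ∑ h ∈ Sᶜ, tensorSq (ν h)

/-- The structure condition `(SC)_{U,Ω}`, where `U` is the span of the `ν^h`, `h ∈ S`. -/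
structure StructureCondition {n : ℕ} (ν : OrthonormalBasis (Fin n) ℝ (E n)) (S : Finset (Fin n))
    (Ω : Set (E n)) (F : Operator n) : Prop where
  /-- `F` is continuous on `Ω × ℝ × ℝⁿ × 𝒮ⁿ`. -/
  continuousOn : ContinuousOn (fun q : E n × ℝ × E n × Mat n => F q.1 q.2.1 q.2.2.1 q.2.2.2)
    (Ω ×ˢ (univ : Set ℝ) ×ˢ (univ : Set (E n)) ×ˢ {X : Mat n | X.IsSymm})
  /-- Degenerate ellipticity. -/
  degenerateElliptic : ∀ x ∈ Ω, ∀ (s : ℝ) (p : E n) (X Y : Mat n), X.IsSymm → Y.IsSymm →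
    (Y - X).PosSemidef → F x s p X ≤ F x s p Y
  /-- `F` is nonincreasing in `s`. -/
  antitone_s : ∀ x ∈ Ω, ∀ (s r : ℝ) (p : E n) (X : Mat n), X.IsSymm → r < s →
    F x s p X ≤ F x r p X
  /-- `F(x, 0, 0, O) = 0`. -/
  zero : ∀ x ∈ Ω, F x 0 0 0 = 0
  /-- Strict ellipticity in one direction `ν^h` of `U`, with a positive continuous `lam` that has a
  positive lower limit at infinity, and Lipschitz continuity in `p` with a bounded continuous `γ`
  such that `γ / lam` is bounded above. -/
  elliptic_and_lipschitz : ∃ lam : E n → ℝ, ContinuousOn lam Ω ∧ (∀ x ∈ Ω, 0 < lam x) ∧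
    (∃ c > 0, ∀ᶠ x in Bornology.cobounded (E n) ⊓ 𝓟 Ω, c ≤ lam x) ∧
    (∃ h ∈ S, ∀ x ∈ Ω, ∀ (p : E n) (X : Mat n), X.IsSymm → ∀ t : ℝ, 0 < t →
      lam x * t ≤ F x 0 p (X + t • tensorSq (ν h)) - F x 0 p X) ∧
    (∃ γ : E n → ℝ, ContinuousOn γ Ω ∧ (∃ B : ℝ, ∀ x ∈ Ω, |γ x| ≤ B) ∧
      (∃ Γ : ℝ, 0 ≤ Γ ∧ ∀ x ∈ Ω, γ x / lam x ≤ Γ) ∧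
      ∀ x ∈ Ω, ∀ (p q : E n) (X : Mat n), X.IsSymm →
        |F x 0 p X - F x 0 q X| ≤ γ x * ‖p - q‖)
  /-- At most linear growth, at infinity, of the difference quotients of `F` with respect to the
  increments in the directions of `U^⊥`. -/
  growth : ∃ Lam₁ : ℝ, 0 < Lam₁ ∧ ∃ Lam : E n → ℝ, ContinuousOn Lam Ω ∧
    (∀ x ∈ Ω, 0 ≤ Lam x ∧ Lam x ≤ Lam₁ * ‖x‖) ∧
    ∀ᶠ x in Bornology.cobounded (E n) ⊓ 𝓟 Ω, ∀ X : Mat n, X.IsSymm → ∀ t : ℝ, 0 < t →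
      F x 0 0 (X + t • projPerp ν S) - F x 0 0 X ≤ Lam x * t

/-- `F` is uniformly elliptic in `N`: its difference quotients are controlled from below and from
above, with respect to all positive semidefinite increments. -/
def UniformlyEllipticOn {n : ℕ} (F : Operator n) (N : Set (E n)) : Prop :=
  ∃ lam Lam : ℝ, 0 < lam ∧ lam ≤ Lam ∧
    ∀ x ∈ N, ∀ (s : ℝ) (p : E n) (X Y : Mat n), X.IsSymm → Y.PosSemidef →
      lam * Y.trace ≤ F x s p (X + Y) - F x s p X ∧
        F x s p (X + Y) - F x s p X ≤ Lam * Y.trace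

/-- The data of a 1-infinite cylinder whose edges are parallel to the vectors of a given
orthonormal basis: the index of its axis, and for each index a lower end and a positive width
(those at the index of the axis play no role). -/
structure Cylinder (n : ℕ) where
  axis : Fin n
  lower : Fin n → ℝ
  width : Fin n → ℝ
  width_pos : ∀ h, 0 < width h

/-- The (open) 1-infinite cylinder `{x : a_h < x · ν^h < a_h + d_h for all h ≠ axis}`. -/
def Cylinder.carrier {n : ℕ} (C : Cylinder n) (ν : OrthonormalBasis (Fin n) ℝ (E n)) :
    Set (E n) :=
  {x | ∀ h, h ≠ C.axis →
    C.lower h < inner ℝ x (ν h) ∧ inner ℝ x (ν h) < C.lower h + C.width h}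

/-- Indices of the bounded directions of a 1-infinite cylinder: the corresponding vectors span the
`(n-1)`-dimensional subspace orthogonal to the axis. -/
def Cylinder.boundedDirections {n : ℕ} (C : Cylinder n) : Finset (Fin n) := {C.axis}ᶜ

/-- A finite family of 1-infinite cylinders forms a lattice if any two of them with the same axis
direction are disjoint, so that they only cross at bounded nodes. -/
def IsLattice {n m : ℕ} (ν : OrthonormalBasis (Fin n) ℝ (E n)) (C : Fin m → Cylinder n) : Prop :=
  ∀ i j, i ≠ j → (C i).axis = (C j).axis → Disjoint ((C i).carrier ν) ((C j).carrier ν)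

/-- The lattice domain: the union of the cylinders. -/
def latticeDomain {n m : ℕ} (ν : OrthonormalBasis (Fin n) ℝ (E n)) (C : Fin m → Cylinder n) :
    Set (E n) :=
  ⋃ i, (C i).carrier ν

/-- The nodes: the points that belong to more than one cylinder. -/
def nodes {n m : ℕ} (ν : OrthonormalBasis (Fin n) ℝ (E n)) (C : Fin m → Cylinder n) :
    Set (E n) :=
  {x | ∃ i j, i ≠ j ∧ x ∈ (C i).carrier ν ∧ x ∈ (C j).carrier ν}

open Classical in
/-- The function `u₀⁺`: the positive part of `u` on the closure of `Ω`, and `0` elsewhere. -/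
noncomputable def posPartExt {n : ℕ} (Ω : Set (E n)) (u : E n → ℝ) (x : E n) : ℝ :=
  if x ∈ closure Ω then max (u x) 0 else 0

/-- `u₀⁺(x) = o(|x|)` as `x → ∞` in `Ω` (no condition if `Ω` is bounded). -/
def SublinearGrowth {n : ℕ} (Ω : Set (E n)) (u : E n → ℝ) : Prop :=
  posPartExt Ω u =o[Bornology.cobounded (E n) ⊓ 𝓟 Ω] fun x => ‖x‖

end LatticeMP

namespace LatticeMP

variable {n : ℕ}

/-! Suppose `u` is positive somewhere. Sublinear growth makes `u - ε‖·‖` attain its maximum over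
`closure Ω`. A barrier, exponential across a cylinder and slowly quadratic along its axis, shows
that the maximum points stay in a ball independent of `ε` (`exists_radius_of_isMaxOn`). Letting `ε →
0`, the supremum `M > 0` of `u` is attained, on a compact set `K ⊆ Ω` (`exists_isMaxOn_of_pos`).

`K` misses the nodes (`lt_of_mem_nodes`): there the operator is uniformly elliptic, so the strong
maximum principle spreads the value `M` along the axis of a crossing cylinder, further than an
extremal point of `K` allows. Hence `K` splits into compact pieces, each inside a single cylinder.
An exponential barrier, a strict supersolution there, excludes every piece
(`lt_of_isCompact_setOf_le`), although the operator may be degenerate in all directions but one. -/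

theorem tensorSq_isSymm (v : E n) : (tensorSq v).IsSymm := by
  ext i j; simp [tensorSq, mul_comm]

theorem tensorSq_trace (v : E n) : (tensorSq v).trace = ‖v‖ ^ 2 := by
  rw [EuclideanSpace.norm_sq_eq]
  simp [Matrix.trace, tensorSq, pow_two]

theorem tensorSq_posSemidef (v : E n) : (tensorSq v).PosSemidef := by
  have h : tensorSq v = Matrix.vecMulVec (fun i => v i) (star fun i => v i) := by
    ext i j; simp [tensorSq, Matrix.vecMulVec_apply]
  rw [h]
  exact Matrix.posSemidef_vecMulVec_self_star _

/-! ### Derivatives of the barriers -/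

/-- Gradient and Hessian of a function with an everywhere given differentiable gradient. -/
theorem gradient_hessian_eq {φ : E n → ℝ} {G : E n → E n} {x : E n} {H : E n →L[ℝ] E n}
    (hφ : ∀ y, HasFDerivAt φ (innerSL ℝ (G y)) y) (hG : HasFDerivAt G H x) :
    gradient φ x = G x ∧
      hessian φ x = Matrix.of fun i j => H (EuclideanSpace.single i 1) j := by
  constructor
  · exact (hasGradientAt_iff_hasFDerivAt.2 (hφ x)).gradient
  · have h1 : fderiv ℝ φ = fun y => innerSL ℝ (G y) := funext fun y => (hφ y).fderiv
    ext i j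
    have h2 : HasFDerivAt (fun y => innerSL ℝ (G y)) ((innerSL ℝ).comp H) x :=
      ((innerSL ℝ (E := E n)).hasFDerivAt (x := G x)).comp x hG
    simp only [hessian, Matrix.of_apply, h1, h2.fderiv]
    simp [EuclideanSpace.inner_single_right]

/-- The barrier used inside a cylinder: exponential in one direction, quadratic in another. -/
noncomputable def cylBarrier (v w : E n) (B k T c y₀ : ℝ) (x : E n) : ℝ :=
  -B * Real.exp (k * (inner ℝ x v - T)) + c * (inner ℝ x w - y₀) ^ 2

theorem contDiff_cylBarrier (v w : E n) (B k T c y₀ : ℝ) :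
    ContDiff ℝ 2 (cylBarrier v w B k T c y₀) := by
  unfold cylBarrier
  have hin : ∀ z : E n, ContDiff ℝ 2 fun x : E n => (inner ℝ x z : ℝ) := fun z =>
    contDiff_id.inner ℝ contDiff_const
  have hv := hin v
  have hw := hin w
  fun_prop

theorem cylBarrier_derivs (v w : E n) (B k T c y₀ : ℝ) (x : E n) :
    gradient (cylBarrier v w B k T c y₀) x =
        (-(B * k * Real.exp (k * (inner ℝ x v - T)))) • v + (2 * c * (inner ℝ x w - y₀)) • w ∧
      hessian (cylBarrier v w B k T c y₀) x =
        (-(B * k ^ 2 * Real.exp (k * (inner ℝ x v - T)))) • tensorSq v +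
          (2 * c) • tensorSq w := by
  have hin : ∀ (z y : E n), HasFDerivAt (fun x : E n => (inner ℝ x z : ℝ)) (innerSL ℝ z) y := by
    intro z y
    have := (innerSL ℝ z).hasFDerivAt (x := y)
    refine this.congr_of_eventuallyEq (Eventually.of_forall fun x => ?_)
    simp [real_inner_comm]
  have he : ∀ y, HasFDerivAt (fun x : E n => Real.exp (k * (inner ℝ x v - T)))
      (Real.exp (k * (inner ℝ y v - T)) • k • innerSL ℝ v) y := fun y =>
    (((hin v y).sub_const T).const_mul k).exp
  have h1 : ∀ y, HasFDerivAt (cylBarrier v w B k T c y₀)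
      (innerSL ℝ ((-(B * k * Real.exp (k * (inner ℝ y v - T)))) • v +
        (2 * c * (inner ℝ y w - y₀)) • w)) y := by
    intro y
    have := ((he y).const_mul (-B)).add ((((hin w y).sub_const y₀).pow 2).const_mul c)
    refine this.congr_fderiv ?_
    ext z
    simp
    ring
  have h2 : HasFDerivAt (fun y : E n => (-(B * k * Real.exp (k * (inner ℝ y v - T)))) • v +
        (2 * c * (inner ℝ y w - y₀)) • w)
      (((-(B * k)) • (Real.exp (k * (inner ℝ x v - T)) • k • innerSL ℝ v)).smulRight v +
        ((2 * c) • innerSL ℝ w).smulRight w) x := by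
    have := (((he x).const_mul (-(B * k))).smul_const v).add
      ((((hin w x).sub_const y₀).const_mul (2 * c)).smul_const w)
    refine this.congr_of_eventuallyEq (Eventually.of_forall fun y => ?_)
    simp
  refine ⟨(gradient_hessian_eq h1 h2).1, (gradient_hessian_eq h1 h2).2.trans ?_⟩
  ext i j
  simp [tensorSq, EuclideanSpace.inner_single_right]
  ring

/-- The barrier of Hopf type. -/
noncomputable def hopfBarrier (y : E n) (ε α : ℝ) (x : E n) : ℝ :=
  -ε * Real.exp (-α * ‖x - y‖ ^ 2)

theorem contDiff_hopfBarrier (y : E n) (ε α : ℝ) : ContDiff ℝ 2 (hopfBarrier y ε α) := by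
  unfold hopfBarrier
  have : ContDiff ℝ 2 fun x : E n => ‖x - y‖ ^ 2 := (contDiff_id.sub contDiff_const).norm_sq ℝ
  fun_prop

theorem hopfBarrier_derivs (y : E n) (ε α : ℝ) (x : E n) :
    gradient (hopfBarrier y ε α) x =
        (2 * ε * α * Real.exp (-α * ‖x - y‖ ^ 2)) • (x - y) ∧
      hessian (hopfBarrier y ε α) x =
        (2 * ε * α * Real.exp (-α * ‖x - y‖ ^ 2)) • (1 : Mat n) +
          (-(4 * ε * α ^ 2 * Real.exp (-α * ‖x - y‖ ^ 2))) • tensorSq (x - y) := by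
  have he : ∀ z, HasFDerivAt (fun x : E n => Real.exp (-α * ‖x - y‖ ^ 2))
      (Real.exp (-α * ‖z - y‖ ^ 2) • (-α) • (2 • (innerSL ℝ (z - y)))) z := by
    intro z
    have := ((((hasFDerivAt_id z).sub_const y).norm_sq).const_mul (-α)).exp
    simpa using this
  have h1 : ∀ z, HasFDerivAt (hopfBarrier y ε α)
      (innerSL ℝ ((2 * ε * α * Real.exp (-α * ‖z - y‖ ^ 2)) • (z - y))) z := by
    intro z
    refine ((he z).const_mul (-ε)).congr_fderiv ?_
    ext a
    simp
    ring
  have h2 := (((he x).const_mul (2 * ε * α)).smul ((hasFDerivAt_id x).sub_const y))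
  refine ⟨(gradient_hessian_eq h1 h2).1, (gradient_hessian_eq h1 h2).2.trans ?_⟩
  ext i j
  by_cases hij : i = j
  · subst hij
    simp [tensorSq, EuclideanSpace.inner_single_right]
    ring
  · simp [tensorSq, EuclideanSpace.inner_single_right, hij, Ne.symm hij]
    ring

/-! ### Geometry of cylinders and nodes -/

theorem Cylinder.isOpen_carrier (C : Cylinder n) (ν : OrthonormalBasis (Fin n) ℝ (E n)) :
    IsOpen (C.carrier ν) := by
  have : C.carrier ν = ⋂ h, {x | h ≠ C.axis →
      C.lower h < inner ℝ x (ν h) ∧ inner ℝ x (ν h) < C.lower h + C.width h} := by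
    ext x; simp [Cylinder.carrier]
  rw [this]
  refine isOpen_iInter_of_finite fun h => ?_
  by_cases hh : h = C.axis
  · simp [hh]
  · simp only [ne_eq, hh, not_false_eq_true, true_imp_iff]
    have hc : Continuous fun x : E n => (inner ℝ x (ν h) : ℝ) := by fun_prop
    exact isOpen_Ioo.preimage hc

theorem Cylinder.convex_carrier (C : Cylinder n) (ν : OrthonormalBasis (Fin n) ℝ (E n)) :
    Convex ℝ (C.carrier ν) := by
  intro x hx y hy a b ha hb hab h hh
  obtain ⟨hx1, hx2⟩ := hx h hh
  obtain ⟨hy1, hy2⟩ := hy h hh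
  simp only [inner_add_left, inner_smul_left, RCLike.conj_to_real]
  have hb' : b = 1 - a := by linarith
  have ha1 : a ≤ 1 := by linarith
  subst hb'
  rcases ha.eq_or_lt with rfl | ha
  · constructor <;> linarith
  · constructor <;> nlinarith

/-- The points of the closure of a cylinder satisfy the weak inequalities. -/
theorem Cylinder.closure_carrier_subset (C : Cylinder n) (ν : OrthonormalBasis (Fin n) ℝ (E n))
    {x : E n} (hx : x ∈ closure (C.carrier ν)) {h : Fin n} (hh : h ≠ C.axis) :
    C.lower h ≤ inner ℝ x (ν h) ∧ inner ℝ x (ν h) ≤ C.lower h + C.width h := by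
  have hc : Continuous fun x : E n => (inner ℝ x (ν h) : ℝ) := by fun_prop
  have hsub : C.carrier ν ⊆
      (fun x : E n => (inner ℝ x (ν h) : ℝ)) ⁻¹' Icc (C.lower h) (C.lower h + C.width h) :=
    fun y hy => ⟨(hy h hh).1.le, (hy h hh).2.le⟩
  exact closure_minimal hsub (isClosed_Icc.preimage hc) hx

theorem norm_le_sum_abs_inner (ν : OrthonormalBasis (Fin n) ℝ (E n)) (x : E n) :
    ‖x‖ ≤ ∑ h, |inner ℝ x (ν h)| := by
  conv_lhs => rw [← ν.sum_repr' x]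
  refine (norm_sum_le _ _).trans (Finset.sum_le_sum fun h _ => ?_)
  rw [norm_smul, ν.norm_eq_one, mul_one, Real.norm_eq_abs, real_inner_comm]

/-- Two points of the closure of a cylinder differ, up to a bounded amount, along the axis only. -/
theorem Cylinder.norm_sub_le (C : Cylinder n) (ν : OrthonormalBasis (Fin n) ℝ (E n))
    {x y : E n} (hx : x ∈ closure (C.carrier ν)) (hy : y ∈ closure (C.carrier ν)) :
    ‖x - y‖ ≤ |inner ℝ x (ν C.axis) - inner ℝ y (ν C.axis)| + ∑ h, C.width h := by
  refine (norm_le_sum_abs_inner ν _).trans ?_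
  have hb : ∀ h, |inner ℝ (x - y) (ν h)| ≤
      (if h = C.axis then |inner ℝ x (ν C.axis) - inner ℝ y (ν C.axis)| else 0) + C.width h := by
    intro h
    by_cases hh : h = C.axis
    · subst hh
      simpa [inner_sub_left] using (C.width_pos _).le
    · obtain ⟨h1, h2⟩ := C.closure_carrier_subset ν hx hh
      obtain ⟨h3, h4⟩ := C.closure_carrier_subset ν hy hh
      simp only [hh, if_false, zero_add, inner_sub_left, abs_le]
      constructor <;> linarith
  refine (Finset.sum_le_sum fun h _ => hb h).trans_eq ?_
  rw [Finset.sum_add_distrib]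
  simp

/-- Two distinct cylinders that meet have different axes, so each coordinate is confined by at least
one of them. -/
theorem isBounded_nodes {m : ℕ} (ν : OrthonormalBasis (Fin n) ℝ (E n)) (C : Fin m → Cylinder n)
    (hC : IsLattice ν C) : Bornology.IsBounded (nodes ν C) := by
  refine (isBounded_iff_forall_norm_le).2
    ⟨∑ h, ∑ i, (|(C i).lower h| + (C i).width h), fun x hx => ?_⟩
  obtain ⟨i, j, hij, hi, hj⟩ := hx
  refine (norm_le_sum_abs_inner ν _).trans (Finset.sum_le_sum fun h _ => ?_)
  have key : ∃ l, h ≠ (C l).axis ∧ x ∈ (C l).carrier ν := by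
    by_cases hh : h = (C i).axis
    · refine ⟨j, fun hj' => ?_, hj⟩
      exact Set.disjoint_left.1 (hC i j hij (hh ▸ hj')) hi hj
    · exact ⟨i, hh, hi⟩
  obtain ⟨l, hl, hxl⟩ := key
  obtain ⟨h1, h2⟩ := hxl h hl
  have h3 : |inner ℝ x (ν h)| ≤ |(C l).lower h| + (C l).width h := by
    have := neg_abs_le ((C l).lower h)
    have := le_abs_self ((C l).lower h)
    have := (C l).width_pos h
    rw [abs_le]; constructor <;> linarith
  exact h3.trans (Finset.single_le_sum
    (f := fun i => |(C i).lower h| + (C i).width h)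
    (fun i _ => add_nonneg (abs_nonneg _) ((C i).width_pos h).le) (Finset.mem_univ l))

/-! ### The operator at the cylinder barriers -/

theorem projPerp_boundedDirections (ν : OrthonormalBasis (Fin n) ℝ (E n)) (C : Cylinder n) :
    projPerp ν C.boundedDirections = tensorSq (ν C.axis) := by
  simp [projPerp, Cylinder.boundedDirections]

/-- The value of the operator at the barrier of a cylinder; with a quadratic part only far away. -/
theorem StructureCondition.barrier_le {ν : OrthonormalBasis (Fin n) ℝ (E n)} {C : Cylinder n}
    {F : Operator n} (hF : StructureCondition ν C.boundedDirections (C.carrier ν) F) :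
    ∃ h, h ≠ C.axis ∧ ∃ (lam : E n → ℝ) (Γ c₀ L R : ℝ), 0 ≤ Γ ∧ 0 < c₀ ∧ 0 < L ∧
      (∀ x ∈ C.carrier ν, 0 < lam x) ∧ (∀ x ∈ C.carrier ν, R ≤ ‖x‖ → c₀ ≤ lam x) ∧
      ∀ x ∈ C.carrier ν, ∀ s > 0, ∀ B > 0, ∀ k > 0, ∀ T, ∀ c ≥ 0, ∀ y₀, c = 0 ∨ R ≤ ‖x‖ →
        F x s (gradient (cylBarrier (ν h) (ν C.axis) B k T c y₀) x)
            (hessian (cylBarrier (ν h) (ν C.axis) B k T c y₀) x) ≤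
          lam x * (-(B * k ^ 2 * Real.exp (k * (inner ℝ x (ν h) - T))) +
            Γ * (B * k * Real.exp (k * (inner ℝ x (ν h) - T)) +
              2 * c * |inner ℝ x (ν C.axis) - y₀|)) + 2 * c * (L * ‖x‖) := by
  obtain ⟨lam, -, hpos, ⟨c₀, hc₀, hev⟩, ⟨h, hS, hell⟩, γ, -, -, ⟨Γ, hΓ, hγ⟩, hlip⟩ :=
    hF.elliptic_and_lipschitz
  obtain ⟨L, hL, Lam, -, hLam, hgr⟩ := hF.growth
  have hev' := hev.and hgr
  rw [eventually_inf_principal, ← comap_norm_atTop, eventually_comap] at hev'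
  obtain ⟨R, hR⟩ := eventually_atTop.1 hev'
  have hh : h ≠ C.axis := by simpa [Cylinder.boundedDirections] using hS
  refine ⟨h, hh, lam, Γ, c₀, L, R, hΓ, hc₀, hL, hpos, fun x hx hxR => (hR _ hxR x rfl hx).1, ?_⟩
  intro x hx s hs B hB k hk T c hc y₀ hcR
  obtain ⟨hg, hH⟩ := cylBarrier_derivs (ν h) (ν C.axis) B k T c y₀ x
  rw [hg, hH]
  set e := Real.exp (k * (inner ℝ x (ν h) - T)) with he
  have he0 : 0 < e := Real.exp_pos _
  set a := B * k ^ 2 * e with ha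
  have ha0 : 0 < a := by positivity
  set p := (-(B * k * e)) • ν h + (2 * c * (inner ℝ x (ν C.axis) - y₀)) • ν C.axis with hp
  have hs1 : ((-a) • tensorSq (ν h)).IsSymm := (tensorSq_isSymm _).smul _
  have hs2 : ((2 * c) • tensorSq (ν C.axis)).IsSymm := (tensorSq_isSymm _).smul _
  have h1 := hF.antitone_s x hx s 0 p _ (hs1.add hs2) hs
  have h2 := hlip x hx p 0 _ (hs1.add hs2)
  rw [sub_zero] at h2
  have h2 := (abs_le.1 h2).2
  -- The increment `a` brings the matrix back to `O`, where `F` vanishes; so `F` is at most `-lam x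
  -- * a` before the increment.
  have h3 := hell x hx 0 _ hs1 a ha0
  rw [neg_smul, neg_add_cancel, hF.zero x hx, ← neg_smul] at h3
  have h4 : F x 0 0 ((-a) • tensorSq (ν h) + (2 * c) • tensorSq (ν C.axis)) ≤
      F x 0 0 ((-a) • tensorSq (ν h)) + 2 * c * (L * ‖x‖) := by
    rcases hc.eq_or_lt with rfl | hc'
    · simp
    · have h5 := (hR _ (hcR.resolve_left hc'.ne') x rfl hx).2 _ hs1 (2 * c) (by positivity)
      rw [projPerp_boundedDirections] at h5
      have := mul_le_mul_of_nonneg_right (hLam x hx).2 (by positivity : (0 : ℝ) ≤ 2 * c)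
      linarith
  have hpn : ‖p‖ ≤ B * k * e + 2 * c * |inner ℝ x (ν C.axis) - y₀| := by
    refine (norm_add_le _ _).trans (le_of_eq ?_)
    rw [norm_smul, norm_smul, ν.norm_eq_one, ν.norm_eq_one, mul_one, mul_one, Real.norm_eq_abs,
      Real.norm_eq_abs, abs_neg, abs_of_pos (by positivity), abs_mul,
      abs_of_nonneg (by positivity : (0 : ℝ) ≤ 2 * c)]
  have hγ' : γ x ≤ Γ * lam x := (div_le_iff₀ (hpos x hx)).1 (hγ x hx)
  have h6 : γ x * ‖p‖ ≤ Γ * lam x * (B * k * e + 2 * c * |inner ℝ x (ν C.axis) - y₀|) :=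
    (mul_le_mul_of_nonneg_right hγ' (norm_nonneg _)).trans
      (mul_le_mul_of_nonneg_left hpn (mul_nonneg hΓ (hpos x hx).le))
  linarith

/-- An exponential barrier is strictly contrary to the subsolution property inside a cylinder. -/
theorem StructureCondition.barrier_neg {ν : OrthonormalBasis (Fin n) ℝ (E n)} {C : Cylinder n}
    {F : Operator n} (hF : StructureCondition ν C.boundedDirections (C.carrier ν) F) :
    ∃ h, h ≠ C.axis ∧ ∃ k > 0, ∀ x ∈ C.carrier ν, ∀ s > 0, ∀ B > 0, ∀ T,
      F x s (gradient (cylBarrier (ν h) (ν C.axis) B k T 0 0) x)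
        (hessian (cylBarrier (ν h) (ν C.axis) B k T 0 0) x) < 0 := by
  obtain ⟨h, hh, lam, Γ, c₀, L, R, hΓ, -, -, hpos, -, hle⟩ := hF.barrier_le
  -- For `k = Γ + 1` one has `-k² + Γ k = -k < 0`.
  refine ⟨h, hh, Γ + 1, by positivity, fun x hx s hs B hB T => ?_⟩
  refine (hle x hx s hs B hB (Γ + 1) (by positivity) T 0 le_rfl 0 (Or.inl rfl)).trans_lt ?_
  have h1 : 0 < lam x * (B * (Γ + 1) * Real.exp ((Γ + 1) * (inner ℝ x (ν h) - T))) :=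
    mul_pos (hpos x hx) (by positivity)
  nlinarith

/-- Far away in a cylinder, the combination of an exponential barrier with a flat paraboloid in the
direction of the axis is strictly contrary to the subsolution property. -/
theorem StructureCondition.eventually_barrier_neg {ν : OrthonormalBasis (Fin n) ℝ (E n)}
    {C : Cylinder n} {F : Operator n}
    (hF : StructureCondition ν C.boundedDirections (C.carrier ν) F) :
    ∃ h, h ≠ C.axis ∧ ∃ k > 0, ∃ R > 0, ∀ r ≥ R, ∀ x ∈ C.carrier ν, r / 4 ≤ ‖x‖ → ‖x‖ ≤ 2 * r →
      ∀ s > 0, ∀ μ > 0, ∀ y₀, |inner ℝ x (ν C.axis) - y₀| ≤ r / 2 →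
      F x s (gradient (cylBarrier (ν h) (ν C.axis) (μ / 2) k (C.lower h + C.width h)
          (7 * μ / r ^ 2) y₀) x)
        (hessian (cylBarrier (ν h) (ν C.axis) (μ / 2) k (C.lower h + C.width h)
          (7 * μ / r ^ 2) y₀) x) < 0 := by
  obtain ⟨h, hh, lam, Γ, c₀, L, R, hΓ, hc₀, hL, hpos, hlow, hle⟩ := hF.barrier_le
  set k := Γ + 1 with hk
  have hk0 : 0 < k := by positivity
  set e₀ := Real.exp (k * (-C.width h)) with he₀
  have he₀0 : 0 < e₀ := Real.exp_pos _
  -- The exponential part contributes at most `-lam x * μ * k * e₀ / 2`, the paraboloid at most `lam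
  -- x * μ * A / r`: `7 * Γ` comes from its gradient, `28 * L / c₀` from its second derivative along
  -- the axis. The factor `μ` cancels, so the threshold on `r` is independent of it.
  set A := 7 * Γ + 28 * L / c₀ with hA
  have hA0 : 0 < A := by positivity
  refine ⟨h, hh, k, hk0, 4 * |R| + 2 * A / (k * e₀) + 1, by positivity, ?_⟩
  intro r hr x hx hxr hxr' s hs μ hμ y₀ hy
  have hq : 0 < 2 * A / (k * e₀) := by positivity
  have hr0 : 0 < r := by have := abs_nonneg R; linarith
  have hxR : R ≤ ‖x‖ := by have := le_abs_self R; linarith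
  have hlam := hlow x hx hxR
  refine (hle x hx s hs (μ / 2) (by positivity) k hk0 _ (7 * μ / r ^ 2) (by positivity) y₀
    (Or.inr hxR)).trans_lt ?_
  set e := Real.exp (k * (inner ℝ x (ν h) - (C.lower h + C.width h))) with he
  have hee : e₀ ≤ e := by
    refine Real.exp_le_exp.2 (mul_le_mul_of_nonneg_left ?_ hk0.le)
    have := (hx h hh).1
    linarith
  have h1 : A < r * (k * e₀ / 2) := by
    have : 2 * A / (k * e₀) < r := by have := abs_nonneg R; linarith
    rw [div_lt_iff₀ (by positivity)] at this
    linarith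
  have h2 : 2 * (7 * μ / r ^ 2) * (L * ‖x‖) ≤ lam x * (μ / r * (28 * L / c₀)) := by
    calc 2 * (7 * μ / r ^ 2) * (L * ‖x‖) ≤ 2 * (7 * μ / r ^ 2) * (L * (2 * r)) := by gcongr
      _ = c₀ * (μ / r * (28 * L / c₀)) := by field_simp; ring
      _ ≤ _ := by gcongr
  have h3 : 2 * (7 * μ / r ^ 2) * |inner ℝ x (ν C.axis) - y₀| ≤ μ / r * 7 := by
    calc 2 * (7 * μ / r ^ 2) * |inner ℝ x (ν C.axis) - y₀| ≤ 2 * (7 * μ / r ^ 2) * (r / 2) := by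
          gcongr
      _ = _ := by field_simp
  have h4 : lam x * (Γ * (2 * (7 * μ / r ^ 2) * |inner ℝ x (ν C.axis) - y₀|)) ≤
      lam x * (Γ * (μ / r * 7)) :=
    mul_le_mul_of_nonneg_left (mul_le_mul_of_nonneg_left h3 hΓ) (hpos x hx).le
  have h5 : μ / r * A < μ * (k * e / 2) := by
    calc μ / r * A < μ / r * (r * (k * e₀ / 2)) := by gcongr
      _ = μ * (k * e₀ / 2) := by field_simp
      _ ≤ _ := by gcongr
  have h6 := mul_lt_mul_of_pos_left h5 (hpos x hx)
  have h7 : lam x * (μ / r * A) =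
      lam x * (Γ * (μ / r * 7)) + lam x * (μ / r * (28 * L / c₀)) := by rw [hA]; ring
  have h8 : lam x * (μ * (k * e / 2)) =
      lam x * (μ / 2 * k ^ 2 * e) - lam x * (Γ * (μ / 2 * k * e)) := by
    rw [hk]; ring
  have h9 : lam x * (-(μ / 2 * k ^ 2 * e) + Γ * (μ / 2 * k * e +
      2 * (7 * μ / r ^ 2) * |inner ℝ x (ν C.axis) - y₀|)) =
      -(lam x * (μ / 2 * k ^ 2 * e)) + lam x * (Γ * (μ / 2 * k * e)) +
      lam x * (Γ * (2 * (7 * μ / r ^ 2) * |inner ℝ x (ν C.axis) - y₀|)) := by ring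
  rw [h9]
  linarith

/-! ### Semicontinuous maxima and the strong maximum principle -/

theorem _root_.UpperSemicontinuousOn.sub_continuous {X : Type*} [TopologicalSpace X] {u φ : X → ℝ}
    {s : Set X} (hu : UpperSemicontinuousOn u s) (hφ : Continuous φ) :
    UpperSemicontinuousOn (fun x => u x - φ x) s := by
  have := hu.add (hφ.neg.upperSemicontinuous.upperSemicontinuousOn s)
  simpa [sub_eq_add_neg] using this

/-- An upper semicontinuous function below `M` on a compact set is uniformly below `M`. -/
theorem exists_le_sub_of_compact {X : Type*} [TopologicalSpace X] {u : X → ℝ} {Q : Set X} {M : ℝ}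
    (hQ : IsCompact Q) (hu : UpperSemicontinuousOn u Q) (hlt : ∀ x ∈ Q, u x < M) :
    ∃ η > 0, ∀ x ∈ Q, u x ≤ M - η := by
  rcases Q.eq_empty_or_nonempty with rfl | hne
  · exact ⟨1, one_pos, by simp⟩
  · obtain ⟨z, hz, hmax⟩ := hu.exists_isMaxOn hne hQ
    exact ⟨M - u z, by linarith [hlt z hz], fun x hx => by have : u x ≤ u z := hmax hx; linarith⟩

theorem mem_of_pos {Ω : Set (E n)} (hΩ : IsOpen Ω) {u : E n → ℝ}
    (hbd : ∀ x ∈ frontier Ω, u x ≤ 0) {x : E n} (hx : x ∈ closure Ω) (hu : 0 < u x) : x ∈ Ω := by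
  by_contra h
  exact absurd (hbd x ⟨hx, by rwa [hΩ.interior_eq]⟩) (not_le.2 hu)

theorem IsViscositySubsolution.nonneg_of_isMaxOn {F : Operator n} {Ω S : Set (E n)}
    {u φ : E n → ℝ} (hu : IsViscositySubsolution F Ω u) (hφ : ContDiff ℝ 2 φ) {x : E n}
    (hx : x ∈ Ω) (hS : S ∈ 𝓝 x) (hmax : IsMaxOn (fun y => u y - φ y) S x) :
    0 ≤ F x (u x) (gradient φ x) (hessian φ x) :=
  hu φ hφ.contDiffOn x hx ((hmax.isLocalMax hS).on Ω)

/-- The strong maximum principle for subsolutions of a uniformly elliptic operator. -/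
theorem strong_maximum_principle {F : Operator n} {Ω V : Set (E n)} {u : E n → ℝ}
    (hu : IsViscositySubsolution F Ω u) (husc : UpperSemicontinuousOn u V) (hVΩ : V ⊆ Ω)
    (hVo : IsOpen V) (hVc : IsPreconnected V) {M : ℝ} (hM : 0 < M) (hle : ∀ x ∈ V, u x ≤ M)
    {l L B : ℝ} (hl : 0 < l) (hB : 0 ≤ B)
    (hF : ∀ x ∈ V, ∀ s > 0, ∀ a > 0, ∀ b > 0, ∀ p q : E n,
      F x s p (a • (1 : Mat n) + (-b) • tensorSq q) ≤ L * a - l * b * ‖q‖ ^ 2 + B * ‖p‖)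
    {y : E n} (hy : y ∈ V) (hyM : M ≤ u y) : ∀ x ∈ V, M ≤ u x := by
  have hlt : IsOpen (V ∩ u ⁻¹' Iio M) := by
    obtain ⟨v, hv, hvV⟩ := (upperSemicontinuousOn_iff_preimage_Iio.1 husc) M
    rw [hvV]
    exact hVo.inter hv
  suffices hge : IsOpen (V ∩ u ⁻¹' Ici M) by
    have hsub : V ⊆ (V ∩ u ⁻¹' Ici M) ∪ (V ∩ u ⁻¹' Iio M) := fun x hx => by
      rcases le_or_gt M (u x) with h | h
      exacts [Or.inl ⟨hx, h⟩, Or.inr ⟨hx, h⟩]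
    have hdis : Disjoint (V ∩ u ⁻¹' Ici M) (V ∩ u ⁻¹' Iio M) :=
      Set.disjoint_left.2 fun x h1 h2 => not_lt.2 (show M ≤ u x from h1.2) h2.2
    have := hVc.subset_left_of_subset_union hge hlt hdis hsub ⟨y, hy, hy, hyM⟩
    exact fun x hx => (this hx).2
  rw [isOpen_iff_mem_nhds]
  rintro x₀ ⟨hx₀, hx₀M⟩
  obtain ⟨r, hr, hrV⟩ := Metric.nhds_basis_closedBall.mem_iff.1 (hVo.mem_nhds hx₀)
  refine Metric.nhds_basis_ball.mem_iff.2 ⟨r / 4, by positivity, fun y₁ hy₁ => ?_⟩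
  rw [Metric.mem_ball] at hy₁
  have hy₁V : y₁ ∈ V := hrV (Metric.mem_closedBall.2 (by linarith))
  refine ⟨hy₁V, ?_⟩
  by_contra hy₁M
  rw [mem_preimage, mem_Ici, not_le] at hy₁M
  -- `z` is the closest point to `y₁` where the maximum is attained
  have hsubr : Metric.closedBall x₀ (r / 2) ⊆ V :=
    (Metric.closedBall_subset_closedBall (by linarith)).trans hrV
  -- As `dist x₀ y₁ < r / 4`, every point at least as close to `y₁` as `x₀` lies in this ball, so
  -- minimality within it is enough.
  have hK : IsCompact (Metric.closedBall x₀ (r / 2) ∩ u ⁻¹' Ici M) :=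
    (husc.mono hsubr).isCompact_inter_preimage_Ici (isCompact_closedBall _ _) M
  obtain ⟨z, ⟨hzb, hzM⟩, hzmin⟩ := hK.exists_isMinOn
    ⟨x₀, Metric.mem_closedBall_self (by positivity), hx₀M⟩
    (f := fun x => dist x y₁) (by fun_prop)
  have hz0 : dist z y₁ ≤ dist x₀ y₁ :=
    hzmin (show x₀ ∈ _ from ⟨Metric.mem_closedBall_self (by positivity), hx₀M⟩)
  rw [dist_comm x₀] at hz0
  rw [Metric.mem_closedBall] at hzb
  have hzV : z ∈ V := hsubr (Metric.mem_closedBall.2 hzb)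
  -- The ball about the midpoint `c` with radius `‖b‖` touches the sphere about `y₁` through `z`
  -- from inside, at `z` only. The parallelogram law expresses this, and `u < M` follows on the rest
  -- of the closed ball.
  set b : E n := (2⁻¹ : ℝ) • (z - y₁) with hb
  set c : E n := y₁ + b with hc
  have hzc : z - c = b := by
    have : z - y₁ = (2 : ℝ) • b := by rw [hb, smul_smul]; norm_num
    rw [hc, ← sub_sub, this, two_smul, add_sub_cancel_right]
  have hzy : dist z y₁ = 2 * ‖b‖ := by
    rw [dist_eq_norm, hb, norm_smul]; norm_num; ring
  have hb0 : 0 < ‖b‖ := by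
    have : z ≠ y₁ := fun h => not_lt.2 hzM (h ▸ hy₁M)
    have := dist_pos.2 this
    linarith
  have hball : ∀ x, ‖x - c‖ ≤ ‖b‖ → x ≠ z → u x < M := by
    intro x hx hxz
    by_contra hxM
    rw [not_lt] at hxM
    have hxy : dist x y₁ ≤ 2 * ‖b‖ := by
      have : x - y₁ = (x - c) + b := by rw [hc]; abel
      rw [dist_eq_norm, this]
      exact (norm_add_le _ _).trans (by linarith)
    have hx₀' : dist x x₀ ≤ r / 2 := by
      have := dist_triangle x y₁ x₀
      linarith
    have h1 : dist z y₁ ≤ dist x y₁ := hzmin (show x ∈ _ from ⟨hx₀', hxM⟩)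
    have h2 : ‖(x - c) + b‖ = dist x y₁ := by
      rw [dist_eq_norm, hc]; congr 1; abel
    have h3 := parallelogram_law_with_norm ℝ (x - c) b
    have h4 : (x - c) - b = x - z := by rw [← hzc]; abel
    rw [h2, h4] at h3
    have h5 : 0 < ‖x - z‖ := norm_pos_iff.2 (sub_ne_zero.2 hxz)
    nlinarith [norm_nonneg (x - c)]
  set ρ := ‖b‖ with hρ
  have hDV : Metric.closedBall z (ρ / 2) ⊆ V := fun x hx => hrV <| by
    rw [Metric.mem_closedBall] at hx ⊢
    have := dist_triangle x z x₀
    linarith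
  have hQ : IsCompact (Metric.sphere z (ρ / 2) ∩ Metric.closedBall c ρ) :=
    (isCompact_sphere _ _).inter_right Metric.isClosed_closedBall
  obtain ⟨η, hη, hηQ⟩ := exists_le_sub_of_compact (M := M) hQ
    (husc.mono (inter_subset_left.trans (Metric.sphere_subset_closedBall.trans hDV)))
    (fun x hx => hball x (by simpa [dist_eq_norm] using hx.2) (by
      rintro rfl
      have := hx.1
      simp at this
      linarith))
  -- Chosen so that `2 * l * α * (ρ / 2) ^ 2 = |L| + B * (2 * ρ) + 1`, which beats the other terms
  -- wherever `ρ / 2 ≤ ‖x - c‖ ≤ 2 * ρ`.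
  set α := 2 * (|L| + B * (2 * ρ) + 1) / (l * ρ ^ 2) with hα
  have hα0 : 0 < α := by positivity
  -- The bound by `η` serves the comparison on the sphere; the bound by `M / 2` keeps `u` positive
  -- at the maximum point.
  set ε := min η (M / 2) with hε
  have hε0 : 0 < ε := lt_min hη (by positivity)
  set φ := hopfBarrier c ε α with hφ
  have hφc : ContDiff ℝ 2 φ := contDiff_hopfBarrier _ _ _
  have hφneg : ∀ x, φ x < 0 := fun x => by
    have := mul_pos hε0 (Real.exp_pos (-α * ‖x - c‖ ^ 2))
    simp only [hφ, hopfBarrier]; linarith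
  have hφge : ∀ x, -ε ≤ φ x := fun x => by
    have : Real.exp (-α * ‖x - c‖ ^ 2) ≤ 1 := Real.exp_le_one_iff.2 (by
      have := mul_nonneg hα0.le (sq_nonneg ‖x - c‖); linarith)
    simp only [hφ, hopfBarrier]; nlinarith
  have hzD : z ∈ Metric.closedBall z (ρ / 2) := Metric.mem_closedBall_self (by positivity)
  obtain ⟨x₁, hx₁D, hx₁⟩ := ((husc.mono hDV).sub_continuous hφc.continuous).exists_isMaxOn
    ⟨z, hzD⟩ (isCompact_closedBall _ _)
  have hcmp : u z - φ z ≤ u x₁ - φ x₁ := hx₁ hzD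
  have hzM' : M ≤ u z := hzM
  have hx₁pos : 0 < u x₁ := by
    have := hφneg z; have := hφge x₁; have := min_le_right η (M / 2); linarith
  -- On the sphere `u - φ` stays below its value at `z`: inside the ball about `c` because `u ≤ M -
  -- η`, outside because `u ≤ M` and `φ` exceeds `φ z`.
  have hx₁ball : dist x₁ z < ρ / 2 := by
    refine lt_of_le_of_ne (Metric.mem_closedBall.1 hx₁D) fun heq => ?_
    by_cases hin : dist x₁ c ≤ ρ
    · have := hηQ x₁ ⟨heq, hin⟩
      have := hφneg z; have := hφge x₁; have := min_le_left η (M / 2); linarith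
    · rw [dist_eq_norm, not_le] at hin
      have h1 := hle x₁ (hDV hx₁D)
      have h2 : φ z < φ x₁ := by
        simp only [hφ, hopfBarrier, hzc]
        have : Real.exp (-α * ‖x₁ - c‖ ^ 2) < Real.exp (-α * ‖b‖ ^ 2) := by
          refine Real.exp_lt_exp.2 ?_
          have : ‖b‖ ^ 2 < ‖x₁ - c‖ ^ 2 := by gcongr
          nlinarith
        nlinarith
      linarith
  have hD : Metric.closedBall z (ρ / 2) ∈ 𝓝 x₁ :=
    mem_of_superset (Metric.isOpen_ball.mem_nhds (Metric.mem_ball.2 hx₁ball))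
      Metric.ball_subset_closedBall
  have h0 := hu.nonneg_of_isMaxOn hφc (hVΩ (hDV hx₁D)) hD hx₁
  obtain ⟨hg, hH⟩ := hopfBarrier_derivs c ε α x₁
  rw [hφ, hg, hH] at h0
  set e := Real.exp (-α * ‖x₁ - c‖ ^ 2) with he
  have he0 : 0 < e := Real.exp_pos _
  have h1 := h0.trans (hF x₁ (hDV hx₁D) _ hx₁pos _ (by positivity) _ (by positivity) _ _)
  rw [norm_smul, Real.norm_eq_abs, abs_of_pos (by positivity)] at h1
  have hq1 : ρ / 2 ≤ ‖x₁ - c‖ := by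
    have := norm_sub_norm_le (z - c) (z - x₁)
    rw [sub_sub_sub_cancel_left, hzc, ← dist_eq_norm z, dist_comm] at this
    linarith
  have hq2 : ‖x₁ - c‖ ≤ 2 * ρ := by
    have := norm_add_le (x₁ - z) (z - c)
    rw [sub_add_sub_cancel, hzc, ← dist_eq_norm x₁ z] at this
    linarith
  have h2 : 0 ≤ (2 * ε * α * e) * (L - 2 * l * α * ‖x₁ - c‖ ^ 2 + B * ‖x₁ - c‖) := by
    linarith
  have h3 : 0 ≤ L - 2 * l * α * ‖x₁ - c‖ ^ 2 + B * ‖x₁ - c‖ :=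
    nonneg_of_mul_nonneg_right h2 (by positivity)
  have h4 : 2 * l * α * (ρ / 2) ^ 2 = |L| + B * (2 * ρ) + 1 := by
    rw [hα]; field_simp
  have h5 : 2 * l * α * (ρ / 2) ^ 2 ≤ 2 * l * α * ‖x₁ - c‖ ^ 2 := by gcongr
  have h6 : B * ‖x₁ - c‖ ≤ B * (2 * ρ) := by gcongr
  have := le_abs_self L
  linarith

/-- Uniform ellipticity at a point where a structure condition holds as well. -/
theorem StructureCondition.le_of_uniformlyElliptic {ν : OrthonormalBasis (Fin n) ℝ (E n)}
    {S : Finset (Fin n)} {A N : Set (E n)} {F : Operator n} (hF : StructureCondition ν S A F)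
    (hN : UniformlyEllipticOn F N) :
    ∃ l L B : ℝ, 0 < l ∧ 0 ≤ B ∧ ∀ x ∈ A ∩ N, ∀ s > 0, ∀ a > 0, ∀ b > 0, ∀ p q : E n,
      F x s p (a • (1 : Mat n) + (-b) • tensorSq q) ≤ L * a - l * b * ‖q‖ ^ 2 + B * ‖p‖ := by
  obtain ⟨l, L, hl, -, hell⟩ := hN
  obtain ⟨-, -, -, -, -, γ, -, ⟨B, hB⟩, -, hlip⟩ := hF.elliptic_and_lipschitz
  refine ⟨l, L * n, |B|, hl, abs_nonneg _, fun x ⟨hxA, hxN⟩ s hs a ha b hb p q => ?_⟩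
  have hs1 : (a • (1 : Mat n)).IsSymm := Matrix.isSymm_one.smul _
  have hs2 : (a • (1 : Mat n) + (-b) • tensorSq q).IsSymm := hs1.add ((tensorSq_isSymm q).smul _)
  have h1 := hF.antitone_s x hxA s 0 p _ hs2 hs
  have h2 := hlip x hxA p 0 _ hs2
  rw [sub_zero] at h2
  have h2 := (abs_le.1 h2).2
  have h3 := (hell x hxN 0 0 _ (b • tensorSq q) hs2 ((tensorSq_posSemidef q).smul hb.le)).1
  rw [add_assoc, ← add_smul, neg_add_cancel, zero_smul, add_zero, Matrix.trace_smul,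
    tensorSq_trace, smul_eq_mul] at h3
  have h4 := (hell x hxN 0 0 0 (a • 1) Matrix.isSymm_zero (Matrix.PosSemidef.one.smul ha.le)).2
  rw [zero_add, hF.zero x hxA, Matrix.trace_smul, Matrix.trace_one, Fintype.card_fin,
    smul_eq_mul] at h4
  have h5 : γ x * ‖p‖ ≤ |B| * ‖p‖ := by
    have := le_abs_self (γ x); have := hB x hxA; have := le_abs_self B
    gcongr
    linarith
  linarith

/-! ### Existence of a positive maximum -/

/-- Far away in a cylinder there is no positive maximum of `u - ε‖·‖` with `ε‖x‖ ≤ u x`. -/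
theorem exists_radius_of_isMaxOn {m : ℕ} {ν : OrthonormalBasis (Fin n) ℝ (E n)}
    {C : Fin m → Cylinder n} (hC : IsLattice ν C) {F : Operator n} {j : Fin m}
    (hF : StructureCondition ν (C j).boundedDirections ((C j).carrier ν) F)
    {Ω : Set (E n)} (hΩo : IsOpen Ω) (hΩ : Ω ⊆ latticeDomain ν C) {u : E n → ℝ}
    (husc : UpperSemicontinuousOn u (closure Ω)) (hsub : IsViscositySubsolution F Ω u)
    (hbd : ∀ x ∈ frontier Ω, u x ≤ 0) :
    ∃ R : ℝ, ∀ ε ≥ 0, ∀ x ∈ Ω ∩ (C j).carrier ν, 0 < u x → ε * ‖x‖ ≤ u x →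
      IsMaxOn (fun y => u y - ε * ‖y‖) (closure Ω) x → ‖x‖ ≤ R := by
  obtain ⟨h, hh, k, hk, R₁, hR₁, hneg⟩ := hF.eventually_barrier_neg
  obtain ⟨R₂, hR₂⟩ := isBounded_iff_forall_norm_le.1 (isBounded_nodes ν C hC)
  set D := ∑ h, (C j).width h with hD
  have hD0 : 0 ≤ D := Finset.sum_nonneg fun h _ => ((C j).width_pos h).le
  -- Beyond `4 * D` the slab `S` lies within `3 / 4 * r` of `x`, hence outside the ball of radius `r
  -- / 4`; beyond `4 * |R₂|` it is clear of the nodes.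
  refine ⟨R₁ + 4 * D + 4 * |R₂|, fun ε hε x ⟨hxΩ, hxC⟩ hux hεx hmax => ?_⟩
  by_contra hxR
  rw [not_le] at hxR
  set r := ‖x‖ with hr
  have hR₂0 := abs_nonneg R₂
  have hr0 : 0 < r := by linarith
  set μ := u x with hμ
  set w := ν (C j).axis with hw
  set y₀ : ℝ := inner ℝ x w with hy₀
  set φ := cylBarrier (ν h) w (μ / 2) k ((C j).lower h + (C j).width h) (7 * μ / r ^ 2) y₀ with hφ
  have hφc : ContDiff ℝ 2 φ := contDiff_cylBarrier _ _ _ _ _ _ _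
  set S := closure Ω ∩ (closure ((C j).carrier ν) ∩ {y : E n | |inner ℝ y w - y₀| ≤ r / 2}) with hS
  have hSdist : ∀ y ∈ S, ‖y - x‖ ≤ 3 / 4 * r := fun y hy => by
    have h1 := (C j).norm_sub_le ν hy.2.1 (subset_closure hxC)
    have h2 : |inner ℝ y w - y₀| ≤ r / 2 := hy.2.2
    linarith
  have hScl : IsClosed S := isClosed_closure.inter
    (isClosed_closure.inter (isClosed_le (by fun_prop) continuous_const))
  have hSc : IsCompact S := (isCompact_closedBall x (3 / 4 * r)).of_isClosed_subset hScl
    fun y hy => by rw [Metric.mem_closedBall, dist_eq_norm]; exact hSdist y hy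
  have hxS : x ∈ S := ⟨subset_closure hxΩ, subset_closure hxC, by
    simp only [mem_ofPred_eq, ← hy₀, sub_self, abs_zero]; positivity⟩
  obtain ⟨z, hzS, hz⟩ := ((husc.mono inter_subset_left).sub_continuous
    hφc.continuous).exists_isMaxOn ⟨x, hxS⟩ hSc
  have hcmp : u x - φ x ≤ u z - φ z := hz hxS
  have hφx : φ x < 0 := by
    have : 0 < μ / 2 * Real.exp (k * (inner ℝ x (ν h) - ((C j).lower h + (C j).width h))) := by
      positivity
    simp only [hφ, cylBarrier, ← hy₀, sub_self]
    linarith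
  have hφz : -(μ / 2) + 7 * μ / r ^ 2 * (inner ℝ z w - y₀) ^ 2 ≤ φ z := by
    have h1 : Real.exp (k * (inner ℝ z (ν h) - ((C j).lower h + (C j).width h))) ≤ 1 := by
      have := ((C j).closure_carrier_subset ν hzS.2.1 hh).2
      exact Real.exp_le_one_iff.2 (mul_nonpos_of_nonneg_of_nonpos hk.le (by linarith))
    simp only [hφ, cylBarrier]
    nlinarith
  have hzpos : 0 < u z := by
    have : 0 ≤ 7 * μ / r ^ 2 * (inner ℝ z w - y₀) ^ 2 := by positivity
    linarith
  have hzΩ : z ∈ Ω := mem_of_pos hΩo hbd hzS.1 hzpos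
  have hzn1 : r / 4 ≤ ‖z‖ := by
    have := norm_sub_norm_le x z
    rw [norm_sub_rev] at this
    linarith [hSdist z hzS]
  have hzn2 : ‖z‖ ≤ r + 3 / 4 * r := by
    have := norm_sub_norm_le z x
    linarith [hSdist z hzS]
  -- Were `z` in another cylinder, an open set, points of `C j` near `z` would be nodes of norm
  -- above `R₂`.
  have hzC : z ∈ (C j).carrier ν := by
    obtain ⟨l, hl⟩ := mem_iUnion.1 (hΩ hzΩ)
    by_cases hjl : j = l
    · exact hjl ▸ hl
    · exfalso
      have ho : IsOpen ((C l).carrier ν ∩ {y | R₂ < ‖y‖}) :=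
        ((C l).isOpen_carrier ν).inter (isOpen_lt continuous_const continuous_norm)
      obtain ⟨y, ⟨hy1, hy2⟩, hy3⟩ := mem_closure_iff.1 hzS.2.1 _ ho
        ⟨hl, by have := le_abs_self R₂; rw [mem_ofPred_eq]; linarith⟩
      exact absurd (hR₂ y ⟨j, l, hjl, hy3, hy1⟩) (not_le.2 hy2)
  have hzw : |inner ℝ z w - y₀| ≤ r / 2 := hzS.2.2
  -- At the ends of the slab `φ ≥ 5 / 4 * μ`, while `ε * r ≤ μ` yields `u z ≤ μ + 3 / 4 * ε * r ≤ 7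
  -- / 4 * μ`. Thus `u z - φ z ≤ μ / 2`, less than the value at `x`.
  have hzw' : |inner ℝ z w - y₀| < r / 2 := by
    refine lt_of_le_of_ne hzw fun heq => ?_
    rw [← sq_abs (inner ℝ z w - y₀), heq] at hφz
    have h1 : 7 * μ / r ^ 2 * (r / 2) ^ 2 = 7 / 4 * μ := by field_simp; norm_num
    have h2 : u z - ε * ‖z‖ ≤ u x - ε * r := hmax hzS.1
    have h3 : ε * ‖z‖ ≤ ε * (r + 3 / 4 * r) := by gcongr
    rw [h1] at hφz
    linarith
  have hSn : S ∈ 𝓝 z := by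
    have ho : IsOpen (Ω ∩ ((C j).carrier ν ∩ {y : E n | |inner ℝ y w - y₀| < r / 2})) :=
      hΩo.inter (((C j).isOpen_carrier ν).inter (isOpen_lt (by fun_prop) continuous_const))
    refine mem_of_superset (ho.mem_nhds ⟨hzΩ, hzC, hzw'⟩) fun y hy =>
      ⟨subset_closure hy.1, subset_closure hy.2.1, (show |inner ℝ y w - y₀| < r / 2 from hy.2.2).le⟩
  have h0 := hsub.nonneg_of_isMaxOn hφc hzΩ hSn hz
  exact absurd h0 (not_le.2 (hneg r (by linarith) z hzC hzn1 (by linarith) _ hzpos μ hux y₀ hzw))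

/-- A subsolution with a positive value and sublinear growth attains its positive supremum, and the
set where it is attained is bounded. -/
theorem exists_isMaxOn_of_pos {m : ℕ} {ν : OrthonormalBasis (Fin n) ℝ (E n)}
    {C : Fin m → Cylinder n} (hC : IsLattice ν C) {F : Operator n}
    (hSC : ∀ i, StructureCondition ν (C i).boundedDirections ((C i).carrier ν) F)
    {Ω : Set (E n)} (hΩo : IsOpen Ω) (hΩ : Ω ⊆ latticeDomain ν C) {u : E n → ℝ}
    (husc : UpperSemicontinuousOn u (closure Ω)) (hsub : IsViscositySubsolution F Ω u)
    (hbd : ∀ x ∈ frontier Ω, u x ≤ 0) (hgrowth : SublinearGrowth Ω u)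
    {x₀ : E n} (hx₀ : x₀ ∈ Ω) (hpos : 0 < u x₀) :
    ∃ M > 0, (∀ x ∈ closure Ω, u x ≤ M) ∧ (∃ x ∈ closure Ω, M ≤ u x) ∧
      ∃ R, ∀ x ∈ closure Ω, M ≤ u x → ‖x‖ ≤ R := by
  choose Rj hRj using fun j => exists_radius_of_isMaxOn hC (hSC j) hΩo hΩ husc hsub hbd
  obtain ⟨R, hR⟩ : ∃ R, ∀ j, Rj j ≤ R :=
    ⟨∑ j, |Rj j|, fun j => (le_abs_self _).trans
      (Finset.single_le_sum (f := fun j => |Rj j|) (fun _ _ => abs_nonneg _) (Finset.mem_univ j))⟩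
  have hfar : ∀ ε ≥ 0, ∀ x ∈ closure Ω, 0 < u x → ε * ‖x‖ ≤ u x →
      IsMaxOn (fun y => u y - ε * ‖y‖) (closure Ω) x → ‖x‖ ≤ R := by
    intro ε hε x hx hux hεx hmax
    have hxΩ := mem_of_pos hΩo hbd hx hux
    obtain ⟨j, hj⟩ := mem_iUnion.1 (hΩ hxΩ)
    exact (hRj j ε hε x ⟨hxΩ, hj⟩ hux hεx hmax).trans (hR j)
  -- The condition on `ε` makes the penalized maximum positive, so that `hfar` applies to the
  -- maximum point.
  have hattain : ∀ ε > 0, ε * ‖x₀‖ < u x₀ → ∃ z ∈ closure Ω, ‖z‖ ≤ R ∧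
      u x₀ - ε * ‖x₀‖ ≤ u z - ε * ‖z‖ ∧ IsMaxOn (fun y => u y - ε * ‖y‖) (closure Ω) z := by
    intro ε hε hεx₀
    have hev := hgrowth.bound hε
    rw [eventually_inf_principal, ← comap_norm_atTop, eventually_comap] at hev
    obtain ⟨ρ, hρ⟩ := eventually_atTop.1 hev
    have hle : ∀ y ∈ closure Ω, ρ ≤ ‖y‖ → u y ≤ ε * ‖y‖ := by
      intro y hy hyρ
      by_cases hyΩ : y ∈ Ω
      · have := hρ _ hyρ y rfl hyΩ
        rw [norm_norm, posPartExt, if_pos hy, Real.norm_eq_abs] at this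
        exact (le_max_left _ _).trans ((le_abs_self _).trans this)
      · have := hbd y ⟨hy, by rwa [hΩo.interior_eq]⟩
        exact this.trans (by positivity)
    have hT : IsCompact (closure Ω ∩ Metric.closedBall 0 (max ρ ‖x₀‖)) :=
      (isCompact_closedBall _ _).inter_left isClosed_closure
    have hx₀T : x₀ ∈ closure Ω ∩ Metric.closedBall 0 (max ρ ‖x₀‖) :=
      ⟨subset_closure hx₀, by simp⟩
    obtain ⟨z, hzT, hz⟩ := ((husc.mono inter_subset_left).sub_continuous
      (continuous_const.mul continuous_norm : Continuous fun y : E n => ε * ‖y‖)).exists_isMaxOn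
      ⟨x₀, hx₀T⟩ hT
    have hz₀ : u x₀ - ε * ‖x₀‖ ≤ u z - ε * ‖z‖ := hz hx₀T
    have hmax : IsMaxOn (fun y => u y - ε * ‖y‖) (closure Ω) z := by
      intro y hy
      by_cases hyρ : ‖y‖ ≤ max ρ ‖x₀‖
      · exact hz ⟨hy, by simpa using hyρ⟩
      · have h1 := hle y hy ((le_max_left _ _).trans (not_le.1 hyρ).le)
        change u y - ε * ‖y‖ ≤ u z - ε * ‖z‖
        linarith
    have h0 : 0 ≤ ε * ‖z‖ := by positivity
    exact ⟨z, hzT.1, hfar ε hε.le z hzT.1 (by linarith) (by linarith) hmax, hz₀, hmax⟩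
  have hT : IsCompact (closure Ω ∩ Metric.closedBall 0 R) :=
    (isCompact_closedBall _ _).inter_left isClosed_closure
  set ε₀ := u x₀ / (‖x₀‖ + 1) with hε₀
  have hε₀0 : 0 < ε₀ := by positivity
  have hε₀x : ε₀ * ‖x₀‖ < u x₀ := by
    rw [hε₀, div_mul_eq_mul_div, div_lt_iff₀ (by positivity)]
    linarith
  obtain ⟨z₀, hz₀, hz₀R, hz₀u, -⟩ := hattain ε₀ hε₀0 hε₀x
  have hz₀T : z₀ ∈ closure Ω ∩ Metric.closedBall 0 R := ⟨hz₀, by simpa using hz₀R⟩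
  obtain ⟨z, hzT, hz⟩ := (husc.mono inter_subset_left).exists_isMaxOn ⟨z₀, hz₀T⟩ hT
  have hzz : u z₀ ≤ u z := hz hz₀T
  have hzpos : 0 < u z := by
    have : 0 ≤ ε₀ * ‖z₀‖ := by positivity
    linarith
  have hle : ∀ x ∈ closure Ω, u x ≤ u z := by
    intro x hx
    have hlim : Tendsto (fun ε : ℝ => u x - ε * ‖x‖) (𝓝[>] 0) (𝓝 (u x)) := by
      have : Continuous fun ε : ℝ => u x - ε * ‖x‖ := by fun_prop
      simpa using (this.tendsto 0).mono_left nhdsWithin_le_nhds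
    refine le_of_tendsto hlim ?_
    filter_upwards [Ioo_mem_nhdsGT hε₀0] with ε hε
    have hεx₀ : ε * ‖x₀‖ < u x₀ := by
      have : ε * ‖x₀‖ ≤ ε₀ * ‖x₀‖ := by gcongr; exact hε.2.le
      linarith
    obtain ⟨y, hy, hyR, -, hymax⟩ := hattain ε hε.1 hεx₀
    have h1 : u x - ε * ‖x‖ ≤ u y - ε * ‖y‖ := hymax hx
    have h2 : u y ≤ u z := hz ⟨hy, by simpa using hyR⟩
    have h3 : 0 ≤ ε * ‖y‖ := mul_nonneg hε.1.le (norm_nonneg _)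
    linarith
  refine ⟨u z, hzpos, hle, ⟨z, hzT.1, le_rfl⟩, R, fun x hx hux => ?_⟩
  -- The case `ε = 0` of the radius bound confines the maximum points of `u` itself.
  refine hfar 0 le_rfl x hx (hzpos.trans_le hux) (by rw [zero_mul]; linarith) fun y hy => ?_
  have := hle y hy
  simp only [mem_ofPred_eq, zero_mul, sub_zero]
  linarith

/-! ### Excluding maximum points in cylinders and at nodes -/

/-- If the set where a subsolution attains its maximum has a compact trace on a cylinder, then this
trace is empty. -/
theorem lt_of_isCompact_setOf_le {ν : OrthonormalBasis (Fin n) ℝ (E n)}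
    {C : Cylinder n} {F : Operator n}
    (hF : StructureCondition ν C.boundedDirections (C.carrier ν) F)
    {Ω : Set (E n)} (hΩo : IsOpen Ω) {u : E n → ℝ} (husc : UpperSemicontinuousOn u (closure Ω))
    (hsub : IsViscositySubsolution F Ω u) {M : ℝ} (hM : 0 < M)
    (hK : IsCompact {x | x ∈ Ω ∩ C.carrier ν ∧ M ≤ u x}) :
    ∀ x ∈ Ω ∩ C.carrier ν, u x < M := by
  intro x hx
  by_contra hxM
  rw [not_lt] at hxM
  set K := {x | x ∈ Ω ∩ C.carrier ν ∧ M ≤ u x} with hKdef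
  obtain ⟨δ, hδ, hδK⟩ := hK.exists_cthickening_subset_open (hΩo.inter (C.isOpen_carrier ν))
    fun y hy => hy.1
  obtain ⟨h, hh, k, hk, hneg⟩ := hF.barrier_neg
  have hW : IsCompact (Metric.cthickening δ K) := hK.cthickening
  have huW : UpperSemicontinuousOn u (Metric.cthickening δ K) :=
    husc.mono fun y hy => subset_closure (hδK hy).1
  have hKt : K ⊆ Metric.thickening δ K := Metric.self_subset_thickening hδ K
  -- Compactness of `K` leaves a shell around it, inside `Ω` and the cylinder, on which `u` is
  -- uniformly below `M`; a barrier with values in `[-η, 0)` then forces an interior maximum.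
  obtain ⟨η, hη, hηQ⟩ := exists_le_sub_of_compact (M := M)
    (hW.diff (Metric.isOpen_thickening (δ := δ) (E := K))) (huW.mono sdiff_subset)
    (fun y hy => by
      by_contra hyM
      exact hy.2 (hKt ⟨hδK hy.1, not_lt.1 hyM⟩))
  set B := min η (M / 2) with hB
  have hB0 : 0 < B := lt_min hη (by positivity)
  set φ := cylBarrier (ν h) (ν C.axis) B k (C.lower h + C.width h) 0 0 with hφ
  have hφc : ContDiff ℝ 2 φ := contDiff_cylBarrier _ _ _ _ _ _ _
  have hφneg : ∀ y, φ y < 0 := fun y => by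
    have := mul_pos hB0 (Real.exp_pos (k * (inner ℝ y (ν h) - (C.lower h + C.width h))))
    simp only [hφ, cylBarrier]
    linarith
  have hφge : ∀ y ∈ C.carrier ν, -B ≤ φ y := fun y hy => by
    have : Real.exp (k * (inner ℝ y (ν h) - (C.lower h + C.width h))) ≤ 1 :=
      Real.exp_le_one_iff.2
        (mul_nonpos_of_nonneg_of_nonpos hk.le (by linarith [(hy h hh).2]))
    simp only [hφ, cylBarrier]
    nlinarith
  have hxK : x ∈ K := ⟨hx, hxM⟩
  have hxW : x ∈ Metric.cthickening δ K := Metric.thickening_subset_cthickening _ _ (hKt hxK)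
  obtain ⟨z, hzW, hz⟩ := (huW.sub_continuous hφc.continuous).exists_isMaxOn ⟨x, hxW⟩ hW
  have hcmp : u x - φ x ≤ u z - φ z := hz hxW
  have h1 := hφneg x
  have h2 := hφge z (hδK hzW).2
  have h3 := min_le_left η (M / 2)
  have h4 := min_le_right η (M / 2)
  have hzt : z ∈ Metric.thickening δ K := by
    by_contra hzt
    have := hηQ z ⟨hzW, hzt⟩
    linarith
  have h0 := hsub.nonneg_of_isMaxOn hφc (hδK hzW).1
    (mem_of_superset (Metric.isOpen_thickening.mem_nhds hzt)
      (Metric.thickening_subset_cthickening _ _)) hz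
  exact absurd h0 (not_le.2 (hneg z (hδK hzW).2 _ (by linarith) B hB0 _))

/-- The positive maximum of a subsolution is not attained at the nodes. -/
theorem lt_of_mem_nodes {m : ℕ} {ν : OrthonormalBasis (Fin n) ℝ (E n)}
    {C : Fin m → Cylinder n} {F : Operator n}
    (hSC : ∀ i, StructureCondition ν (C i).boundedDirections ((C i).carrier ν) F)
    (hN : UniformlyEllipticOn F (nodes ν C))
    {Ω : Set (E n)} (hΩo : IsOpen Ω) (hΩ : Ω ⊆ latticeDomain ν C) {u : E n → ℝ}
    (husc : UpperSemicontinuousOn u (closure Ω)) (hsub : IsViscositySubsolution F Ω u)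
    {M : ℝ} (hM : 0 < M) (hle : ∀ x ∈ Ω, u x ≤ M) (hK : IsCompact {x | x ∈ Ω ∧ M ≤ u x}) :
    ∀ x ∈ Ω ∩ nodes ν C, u x < M := by
  intro x ⟨hxΩ, hxN⟩
  by_contra hxM
  rw [not_lt] at hxM
  set K := {x | x ∈ Ω ∧ M ≤ u x} with hKdef
  have hcl : closure (K ∩ nodes ν C) ⊆ K := closure_minimal inter_subset_left hK.isClosed
  -- `ℓ` increases at unit rate along every `ν h`, so it serves whichever axis is met. The nodes
  -- form an open set, so its maximum is taken on the closure and `z` itself need not be a node.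
  set ℓ : E n → ℝ := fun y => ∑ h, inner ℝ y (ν h) with hℓ
  have hℓc : Continuous ℓ := by fun_prop
  obtain ⟨z, hzcl, hz⟩ := (hK.of_isClosed_subset isClosed_closure hcl).exists_isMaxOn
    ⟨x, subset_closure ⟨⟨hxΩ, hxM⟩, hxN⟩⟩ hℓc.continuousOn
  have hzK := hcl hzcl
  obtain ⟨j, hj⟩ := mem_iUnion.1 (hΩ hzK.1)
  obtain ⟨r, hr, hrsub⟩ := Metric.nhds_basis_ball.mem_iff.1
    ((hΩo.inter ((C j).isOpen_carrier ν)).mem_nhds ⟨hzK.1, hj⟩)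
  -- a maximum point in a node near `z`
  have hU : IsOpen (Metric.ball z (r / 2) ∩ {y | ℓ z - r / 2 < ℓ y}) :=
    Metric.isOpen_ball.inter (isOpen_lt continuous_const hℓc)
  obtain ⟨y, ⟨hyb, hyℓ⟩, hyK, hyN⟩ := mem_closure_iff.1 hzcl _ hU
    ⟨Metric.mem_ball_self (by positivity), by rw [mem_ofPred_eq]; linarith⟩
  rw [Metric.mem_ball] at hyb
  have hyr : y ∈ Metric.ball z r := Metric.mem_ball.2 (by linarith)
  obtain ⟨i, hij, hyi⟩ : ∃ i, i ≠ j ∧ y ∈ (C i).carrier ν := by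
    obtain ⟨a, b, hab, ha, hb⟩ := hyN
    by_cases haj : a = j
    · exact ⟨b, fun hbj => hab (haj.trans hbj.symm), hb⟩
    · exact ⟨a, haj, ha⟩
  -- The ball lies in `C j`, so all of `V` consists of nodes; a shift by `r / 2` along the axis of
  -- `C i` stays in `V` and pushes `ℓ` above `ℓ z`.
  set V := Metric.ball z r ∩ (C i).carrier ν with hV
  have hVo : IsOpen V := Metric.isOpen_ball.inter ((C i).isOpen_carrier ν)
  have hVc : IsPreconnected V :=
    ((convex_ball z r).inter ((C i).convex_carrier ν)).isPreconnected
  have hVΩ : V ⊆ Ω := fun v hv => (hrsub hv.1).1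
  have hVN : V ⊆ nodes ν C := fun v hv => ⟨i, j, hij, hv.2, (hrsub hv.1).2⟩
  obtain ⟨l, L, B, hl, hB, hop⟩ := (hSC i).le_of_uniformlyElliptic hN
  have hmaxV := strong_maximum_principle hsub (husc.mono fun v hv => subset_closure (hVΩ hv)) hVΩ
    hVo hVc hM (fun v hv => hle v (hVΩ hv)) hl hB (fun v hv => hop v ⟨hv.2, hVN hv⟩)
    (y := y) ⟨hyr, hyi⟩ hyK.2
  -- move along the axis of the other cylinder
  set v := y + (r / 2) • ν (C i).axis with hv
  have hin : ∀ h, inner ℝ v (ν h) = inner ℝ y (ν h) + if h = (C i).axis then r / 2 else 0 := by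
    intro h
    rw [hv, inner_add_left, inner_smul_left, orthonormal_iff_ite.1 ν.orthonormal]
    simp [eq_comm]
  have hvV : v ∈ V := by
    constructor
    · have h1 : dist v y = r / 2 := by
        rw [dist_eq_norm, hv, add_sub_cancel_left, norm_smul, ν.norm_eq_one, mul_one,
          Real.norm_eq_abs, abs_of_pos (by positivity)]
      have := dist_triangle v y z
      exact Metric.mem_ball.2 (by linarith)
    · intro h hh
      rw [hin, if_neg hh, add_zero]
      exact hyi h hh
  have hvℓ : ℓ v = ℓ y + r / 2 := by
    simp only [hℓ, hin, Finset.sum_add_distrib]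
    simp
  have hvz : ℓ v ≤ ℓ z := hz (subset_closure ⟨⟨hVΩ hvV, hmaxV v hvV⟩, hVN hvV⟩)
  rw [mem_ofPred_eq] at hyℓ
  linarith

end LatticeMP

theorem corollary1p2 (n : ℕ) (hn : 2 ≤ n)
    (ν : OrthonormalBasis (Fin n) ℝ (LatticeMP.E n))
    (m : ℕ) (C : Fin m → LatticeMP.Cylinder n)
    (hC : LatticeMP.IsLattice ν C)
    (F : LatticeMP.Operator n)
    (hSC : ∀ i, LatticeMP.StructureCondition ν (C i).boundedDirections ((C i).carrier ν) F)
    (hN : LatticeMP.UniformlyEllipticOn F (LatticeMP.nodes ν C))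
    (Ω : Set (LatticeMP.E n)) (hΩo : IsOpen Ω) (hΩc : IsConnected Ω)
    (hΩ : Ω ⊆ LatticeMP.latticeDomain ν C)
    (u : LatticeMP.E n → ℝ)
    (husc : UpperSemicontinuousOn u (closure Ω))
    (hsub : LatticeMP.IsViscositySubsolution F Ω u)
    (hbd : ∀ x ∈ frontier Ω, u x ≤ 0)
    (hgrowth : LatticeMP.SublinearGrowth Ω u) :
    ∀ x ∈ Ω, u x ≤ 0 := by
  intro x₀ hx₀
  by_contra hpos
  obtain ⟨M, hM, hle, ⟨z, hz, hzM⟩, R, hR⟩ :=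
    LatticeMP.exists_isMaxOn_of_pos hC hSC hΩo hΩ husc hsub hbd hgrowth hx₀ (not_le.1 hpos)
  have hleΩ : ∀ x ∈ Ω, u x ≤ M := fun x hx => hle x (subset_closure hx)
  have hK : IsCompact {x | x ∈ Ω ∧ M ≤ u x} := by
    have h1 : IsCompact (closure Ω ∩ Metric.closedBall 0 R) :=
      (isCompact_closedBall _ _).inter_left isClosed_closure
    convert (husc.mono inter_subset_left).isCompact_inter_preimage_Ici h1 M using 1
    ext x
    constructor
    · exact fun hx => ⟨⟨subset_closure hx.1, by simpa using hR x (subset_closure hx.1) hx.2⟩, hx.2⟩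
    · exact fun hx => ⟨LatticeMP.mem_of_pos hΩo hbd hx.1.1 (hM.trans_le hx.2), hx.2⟩
  have hnode := LatticeMP.lt_of_mem_nodes hSC hN hΩo hΩ husc hsub hM hleΩ hK
  have hzΩ := LatticeMP.mem_of_pos hΩo hbd hz (hM.trans_le hzM)
  obtain ⟨j, hj⟩ := mem_iUnion.1 (hΩ hzΩ)
  -- Away from the nodes, lying in `C j` amounts to avoiding the other cylinders, which is a closed
  -- condition.
  have hKj : IsCompact {x | x ∈ Ω ∩ (C j).carrier ν ∧ M ≤ u x} := by
    have ho : IsOpen (⋃ l ∈ {l | l ≠ j}, (C l).carrier ν) :=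
      isOpen_biUnion fun l _ => (C l).isOpen_carrier ν
    convert hK.diff ho using 1
    ext x
    simp only [mem_ofPred_eq, mem_inter_iff, Set.mem_sdiff, mem_iUnion, not_exists]
    constructor
    · rintro ⟨⟨hx, hxj⟩, hxM⟩
      exact ⟨⟨hx, hxM⟩, fun l hl hxl => not_lt.2 hxM (hnode x ⟨hx, l, j, hl, hxl, hxj⟩)⟩
    · rintro ⟨⟨hx, hxM⟩, hxl⟩
      obtain ⟨l, hl⟩ := mem_iUnion.1 (hΩ hx)
      by_cases hlj : l = j
      · exact ⟨⟨hx, hlj ▸ hl⟩, hxM⟩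
      · exact absurd hl (hxl l hlj)
  exact absurd hzM (not_le.2
    (LatticeMP.lt_of_isCompact_setOf_le (hSC j) hΩo husc hsub hM hKj z ⟨hzΩ, hj⟩))
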